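/- Let $X$ be a compact metric space and $T : X \to X$ a homeomorphism. A finite open cover $\mathcal U$ of $X$ is called non-trivial if none of its members is dense in $X$; for a finite cover $\mathcal V$ let $N(\mathcal V)$ denote the least cardinality of a subcover of $\mathcal V$. A set of integers is thick if it contains arbitrarily long intervals, syndetic if its complement is not thick, and piecewise syndetic if it is the intersection of a thick set and a syndetic set. The system $(X,T)$ is called scattering if for every finite non-trivial open cover $\mathcal U$ of $X$ and every piecewise syndetic set $A = \{a_1 < a_2 < \cdots\}$ of positive integers, $$\lim_{n\to\infty} N\Big(\bigvee_{i=1}^{n} T^{-a_i}\,\mathcal U\Big) = \infty .$$ The system $(X,T)$ is called weakly mixing if $(X\times X, T\times T)$ is transitive, that is, if for all non-empty open sets $U, V \subseteq X \times X$ there is $n \in \mathbb Z$ with $(T\times T)^n(U) \cap V \neq \emptyset$. **Theorem.** If $(X,T)$ is scattering and there is a $T$-invariant Borel probability measure on $X$ with full support (every non-empty open set has positive measure), then $(X,T)$ is weakly mixing. -/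

import Mathlib

open Filter Topology MeasureTheory

namespace TDS

/-- A set of integers is thick if it contains arbitrarily long intervals. -/
def IsThick (A : Set ℤ) : Prop :=
  ∀ L : ℕ, ∃ a : ℤ, Set.Icc a (a + L) ⊆ A

/-- A set of integers is syndetic if its complement is not thick. -/
def IsSyndetic (A : Set ℤ) : Prop :=
  ¬ IsThick Aᶜ

/-- A set of integers is piecewise syndetic if it is the intersection of a thick set and a
syndetic set. -/
def IsPiecewiseSyndetic (A : Set ℤ) : Prop :=
  ∃ B C : Set ℤ, IsThick B ∧ IsSyndetic C ∧ A = B ∩ C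

/-- The return times set `N(U, V)` of all integers `n` such that `T^n U` meets `V`. -/
def returnTimes {X : Type*} [TopologicalSpace X] (T : X ≃ₜ X) (U V : Set X) : Set ℤ :=
  {n : ℤ | ((⇑(T ^ n) '' U) ∩ V).Nonempty}

/-- Topological transitivity: `N(U, V)` is non-empty for all non-empty open `U`, `V`. -/
def IsTransitive {X : Type*} [TopologicalSpace X] (T : X ≃ₜ X) : Prop :=
  ∀ U V : Set X, IsOpen U → U.Nonempty → IsOpen V → V.Nonempty → (returnTimes T U V).Nonempty

/-- Weak mixing: the product system `(X × X, T × T)` is transitive. -/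
def IsWeakMixing {X : Type*} [TopologicalSpace X] (T : X ≃ₜ X) : Prop :=
  IsTransitive (T.prodCongr T)

/-- A finite non-trivial open cover: finitely many open sets, none of them dense, covering `X`. -/
structure IsNontrivialCover {X : Type*} [TopologicalSpace X] (𝒰 : Set (Set X)) : Prop where
  finite : 𝒰.Finite
  isOpen : ∀ U ∈ 𝒰, IsOpen U
  not_dense : ∀ U ∈ 𝒰, ¬ Dense U
  cover : ⋃₀ 𝒰 = Set.univ

/-- The least cardinality of a subcover of `𝒰`. It is used only for finite covers `𝒰`, so that the
set of cardinalities is never empty. -/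
noncomputable def coverNumber {X : Type*} (𝒰 : Set (Set X)) : ℕ :=
  sInf {k : ℕ | ∃ 𝒲 : Finset (Set X),
    (𝒲 : Set (Set X)) ⊆ 𝒰 ∧ ⋃₀ (𝒲 : Set (Set X)) = Set.univ ∧ 𝒲.card = k}

/-- The common refinement of the covers `T^(-a 0) 𝒰, …, T^(-a (n-1)) 𝒰`. -/
def joinAlong {X : Type*} [TopologicalSpace X] (T : X ≃ₜ X) (𝒰 : Set (Set X)) (a : ℕ → ℕ)
    (n : ℕ) : Set (Set X) :=
  {W : Set X | ∃ f : Fin n → Set X, (∀ i, f i ∈ 𝒰) ∧ W = ⋂ i : Fin n, ⇑(T ^ a i) ⁻¹' f i}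

/-- The complexity of `𝒰` along the sequence `a` is infinite. -/
def InfiniteComplexity {X : Type*} [TopologicalSpace X] (T : X ≃ₜ X) (𝒰 : Set (Set X))
    (a : ℕ → ℕ) : Prop :=
  Tendsto (fun n => coverNumber (joinAlong T 𝒰 a n)) atTop atTop

/-- Scattering: every finite non-trivial open cover has infinite complexity along every piecewise
syndetic set of positive integers, listed increasingly. -/
def IsScattering {X : Type*} [TopologicalSpace X] (T : X ≃ₜ X) : Prop :=
  ∀ 𝒰 : Set (Set X), IsNontrivialCover 𝒰 →
    ∀ a : ℕ → ℕ, StrictMono a → (∀ i, 0 < a i) →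
      IsPiecewiseSyndetic (Set.range fun i => (a i : ℤ)) → InfiniteComplexity T 𝒰 a

end TDS

namespace TDS

section Combinatorics

/-! Write E(x) for the section over x of the orbit of U × V. It is equivariant, so d(x, y) = μ(E(x)
∆ E(y)) is a T-invariant pseudo-distance. Lower semicontinuity of E gives open sets O of small
d-diameter; returns to O are syndetic (Poincaré) and move points of O little. Scattering makes every
return time set meet the differences of any syndetic set, so whole orbits have small d-diameter. If
the orbit of U₁ × V₁ missed U₂ × V₂, some E(x) would differ from a translate E(T^k x) by an open set
of fixed positive measure. -/

theorem isThick_Ioi_zero : IsThick (Set.Ioi 0) := fun L =>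
  ⟨1, fun n hn => by have := hn.1; simp only [Set.mem_Ioi]; omega⟩

/-- A syndetic set contains arbitrarily large integers. -/
theorem IsSyndetic.exists_gt {A : Set ℤ} (hA : IsSyndetic A) (m : ℤ) : ∃ a ∈ A, m < a := by
  by_contra! h
  exact hA fun L => ⟨m + 1, fun n hn hnA => by have := h n hnA; have := hn.1; omega⟩

/-- A thick set not containing `0` contains, up to sign, the differences of arbitrarily large
finite sets of integers. -/
theorem IsThick.exists_finset_pairwise {D : Set ℤ} (hD : IsThick D) (h0 : (0 : ℤ) ∉ D) (k : ℕ) :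
    ∃ S : Finset ℤ, S.card = k ∧ ∀ i ∈ S, ∀ j ∈ S, i ≠ j → i - j ∈ D ∨ j - i ∈ D := by
  induction k with
  | zero => exact ⟨∅, by simp⟩
  | succ k ih =>
    obtain ⟨S, hk, hS⟩ := ih
    obtain ⟨M, hM⟩ : ∃ M : ℕ, ∀ s ∈ S, |s| ≤ M :=
      ⟨∑ s ∈ S, s.natAbs, fun s hs => by
        have h : s.natAbs ≤ ∑ s ∈ S, s.natAbs :=
          Finset.single_le_sum (f := Int.natAbs) (fun _ _ => Nat.zero_le _) hs
        rw [Int.abs_eq_natAbs]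
        exact_mod_cast h⟩
    -- The midpoint a + M of this interval stays inside it after subtracting any s with |s| ≤ M.
    obtain ⟨a, ha⟩ := hD (2 * M)
    have hn : ∀ s ∈ S, a + M - s ∈ D := fun s hs => ha <| by
      have := abs_le.1 (hM s hs)
      constructor <;> push_cast <;> omega
    have hnS : a + M ∉ S := fun h => h0 <| by simpa using hn _ h
    refine ⟨insert (a + M) S, by rw [Finset.card_insert_of_notMem hnS, hk], fun i hi j hj hij => ?_⟩
    rcases Finset.mem_insert.1 hi with rfl | hi <;> rcases Finset.mem_insert.1 hj with rfl | hj
    · exact absurd rfl hij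
    · exact Or.inl (hn j hj)
    · exact Or.inr (hn i hi)
    · exact hS i hi j hj hij

theorem coverNumber_le_two {X : Type*} {𝒰 : Set (Set X)} {V W : Set X} (hV : V ∈ 𝒰) (hW : W ∈ 𝒰)
    (h : V ∪ W = Set.univ) : coverNumber 𝒰 ≤ 2 := by
  classical
  suffices h2 : coverNumber 𝒰 ≤ ({V, W} : Finset (Set X)).card from h2.trans Finset.card_le_two
  refine Nat.sInf_le ⟨{V, W}, ?_, ?_, rfl⟩
  · simp [Set.insert_subset_iff, hV, hW]
  · simpa using h

end Combinatorics

/-! ### Scattering, return times and orbit sections -/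

section Topological

variable {X : Type*} [TopologicalSpace X]

theorem zpow_add_apply (T : X ≃ₜ X) (m n : ℤ) (x : X) :
    (T ^ (m + n)) x = (T ^ m) ((T ^ n) x) := by
  rw [zpow_add, Homeomorph.mul_apply]

theorem prodCongr_zpow_apply (T : X ≃ₜ X) (n : ℤ) (p : X × X) :
    ((T.prodCongr T) ^ n) p = ((T ^ n) p.1, (T ^ n) p.2) := by
  let φ : (X ≃ₜ X) →* (X × X ≃ₜ X × X) :=
    { toFun := fun S => S.prodCongr S, map_one' := rfl, map_mul' := fun _ _ => rfl }
  have h : φ (T ^ n) = φ T ^ n := map_zpow φ T n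
  exact (congrArg (fun S : X × X ≃ₜ X × X => S p) h).symm

theorem mem_returnTimes {T : X ≃ₜ X} {U V : Set X} {n : ℤ} :
    n ∈ returnTimes T U V ↔ ∃ x ∈ U, (T ^ n) x ∈ V :=
  Set.image_inter_nonempty_iff

theorem not_dense_compl_of_mem_nhds {K : Set X} {x : X} (hK : K ∈ 𝓝 x) : ¬ Dense Kᶜ := fun h => by
  obtain ⟨y, hy, hyK⟩ := mem_closure_iff_nhds.1 (h x) K hK
  exact hyK hy

/-- In a scattering system, return time sets meet the difference set of the positive part of each
syndetic set. -/
theorem IsScattering.exists_sub_mem_returnTimes [RegularSpace X] {T : X ≃ₜ X}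
    (hT : IsScattering T) {C : Set ℤ} (hC : IsSyndetic C) {U V : Set X} (hU : IsOpen U)
    (hU' : U.Nonempty) (hV : IsOpen V) (hV' : V.Nonempty) :
    ∃ a ∈ C, ∃ b ∈ C, a - b ∈ returnTimes T U V := by
  obtain ⟨u, hu⟩ := hU'
  obtain ⟨v, hv⟩ := hV'
  obtain ⟨K, hKn, hKc, hKU⟩ := exists_mem_nhds_isClosed_subset (hU.mem_nhds hu)
  obtain ⟨L, hLn, hLc, hLV⟩ := exists_mem_nhds_isClosed_subset (hV.mem_nhds hv)
  by_contra! h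
  simp only [mem_returnTimes, not_exists, not_and] at h
  have hKL : ∀ x ∈ K, x ∉ L := fun x hxK hxL => by
    obtain ⟨a, ha, -⟩ := hC.exists_gt 0
    refine h a ha a ha x (hKU hxK) ?_
    rw [sub_self]
    exact hLV hxL
  let p : ℕ → Prop := fun n => 0 < n ∧ (n : ℤ) ∈ C
  have hp : {n | p n}.Infinite := by
    refine Set.infinite_of_not_bddAbove fun ⟨m, hm⟩ => ?_
    obtain ⟨a, ha, hma⟩ := hC.exists_gt m
    lift a to ℕ using by omega
    have : a ≤ m := hm (show p a from ⟨by omega, ha⟩)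
    omega
  have hmem : ∀ i, p (Nat.nth p i) := fun i => Nat.nth_mem_of_infinite hp i
  have hrange : (Set.range fun i => (Nat.nth p i : ℤ)) = Set.Ioi 0 ∩ C := by
    ext n
    constructor
    · rintro ⟨i, rfl⟩
      exact ⟨by have := (hmem i).1; simp only [Set.mem_Ioi]; omega, (hmem i).2⟩
    · rintro ⟨hn, hnC⟩
      have hn : 0 < n := hn
      lift n to ℕ using hn.le
      have : n ∈ Set.range (Nat.nth p) := by
        rw [Nat.range_nth_of_infinite hp]
        exact ⟨by omega, hnC⟩
      obtain ⟨i, hi⟩ := this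
      exact ⟨i, by simp only [hi]⟩
  have hcover : IsNontrivialCover ({Kᶜ, Lᶜ} : Set (Set X)) := by
    refine ⟨by simp, ?_, ?_, ?_⟩
    · simp [hKc.isOpen_compl, hLc.isOpen_compl]
    · simp [not_dense_compl_of_mem_nhds hKn, not_dense_compl_of_mem_nhds hLn]
    · rw [Set.sUnion_pair, Set.eq_univ_iff_forall]
      exact fun x => or_iff_not_imp_left.2 fun hx => hKL x (not_not.1 hx)
  have hlim := hT _ hcover (Nat.nth p) (Nat.nth_strictMono hp) (fun i => (hmem i).1)
    ⟨_, _, isThick_Ioi_zero, hC, hrange⟩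
  obtain ⟨n, hn⟩ := (hlim.eventually_gt_atTop 2).exists
  -- Two constant choices cover X: visits to K and L at times in C would give a difference in N(U,
  -- V).
  refine hn.not_ge (coverNumber_le_two (V := ⋂ i : Fin n, ⇑(T ^ Nat.nth p i) ⁻¹' Kᶜ)
    (W := ⋂ i : Fin n, ⇑(T ^ Nat.nth p i) ⁻¹' Lᶜ) ⟨fun _ => Kᶜ, by simp, rfl⟩
    ⟨fun _ => Lᶜ, by simp, rfl⟩ (Set.eq_univ_iff_forall.2 fun x => or_iff_not_imp_left.2 ?_))
  intro hx
  simp only [Set.mem_iInter, not_forall, Set.mem_preimage, Set.mem_compl_iff, not_not] at hx ⊢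
  obtain ⟨j, hj⟩ := hx
  intro i hi
  refine h _ (hmem i).2 _ (hmem j).2 _ (hKU hj) ?_
  rw [← zpow_natCast, ← zpow_add_apply, sub_add_cancel, zpow_natCast]
  exact hLV hi

theorem isSyndetic_univ : IsSyndetic Set.univ := fun h => by
  obtain ⟨a, ha⟩ := h 0
  exact ha (Set.left_mem_Icc.2 (by simp)) trivial

theorem IsScattering.isTransitive [RegularSpace X] {T : X ≃ₜ X} (hT : IsScattering T) :
    IsTransitive T := fun _ _ hU hU' hV hV' => by
  obtain ⟨a, -, b, -, h⟩ := hT.exists_sub_mem_returnTimes isSyndetic_univ hU hU' hV hV'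
  exact ⟨_, h⟩

/-- The section over `x` of the invariant open set `⋃ n, (T × T) ^ n (U × V)`. -/
def orbitSection (T : X ≃ₜ X) (U V : Set X) (x : X) : Set X :=
  {z | ∃ n : ℤ, (T ^ n) x ∈ U ∧ (T ^ n) z ∈ V}

theorem preimage_orbitSection (T : X ≃ₜ X) (U V : Set X) (k : ℤ) (x : X) :
    ⇑(T ^ k) ⁻¹' orbitSection T U V ((T ^ k) x) = orbitSection T U V x := by
  ext z
  simp only [orbitSection, Set.mem_preimage, Set.mem_ofPred_eq, ← zpow_add_apply]
  exact (Equiv.addRight k).exists_congr_left.trans (by simp)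

theorem orbitSection_eq_iUnion (T : X ≃ₜ X) (U V : Set X) (x : X) :
    orbitSection T U V x = ⋃ n : {n : ℤ // (T ^ n) x ∈ U}, ⇑(T ^ (n : ℤ)) ⁻¹' V := by
  ext z
  simp [orbitSection]

theorem isOpen_orbitSection (T : X ≃ₜ X) (U : Set X) {V : Set X} (hV : IsOpen V) (x : X) :
    IsOpen (orbitSection T U V x) := by
  rw [orbitSection_eq_iUnion]
  exact isOpen_iUnion fun n => hV.preimage (T ^ (n : ℤ)).continuous

end Topological

/-! ### Invariant pseudo-distance on sections -/

section Measure

variable {X : Type*} [TopologicalSpace X] [MeasurableSpace X] {T : X ≃ₜ X} {μ : Measure X}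

/-- The `T`-invariant pseudo-distance between points given by the measure of the symmetric
difference of their sections. -/
noncomputable def sectionDist (μ : Measure X) (T : X ≃ₜ X) (U V : Set X) (x y : X) : ℝ :=
  μ.real (symmDiff (orbitSection T U V x) (orbitSection T U V y))

theorem sectionDist_comm (U V : Set X) (x y : X) :
    sectionDist μ T U V x y = sectionDist μ T U V y x := by
  rw [sectionDist, symmDiff_comm, sectionDist]

theorem sectionDist_triangle [IsFiniteMeasure μ] (U V : Set X) (x y z : X) :
    sectionDist μ T U V x z ≤ sectionDist μ T U V x y + sectionDist μ T U V y z :=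
  measureReal_symmDiff_le _

variable [BorelSpace X]

theorem measurePreserving_zpow (hμ : MeasurePreserving (⇑T) μ μ) (n : ℤ) :
    MeasurePreserving (⇑(T ^ n)) μ μ := by
  have hpow : ∀ k : ℕ, MeasurePreserving (⇑(T ^ k)) μ μ := fun k => by
    induction k with
    | zero => exact MeasurePreserving.id μ
    | succ k ih => rw [pow_succ]; exact ih.comp hμ
  obtain ⟨k, rfl | rfl⟩ := n.eq_nat_or_neg
  · rw [zpow_natCast]
    exact hpow k
  · rw [zpow_neg, zpow_natCast]
    exact MeasurePreserving.symm (T ^ k).toMeasurableEquiv (hpow k)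

/-- Poincaré recurrence: returns to an open set of positive measure are syndetic. -/
theorem isSyndetic_returnTimes [IsProbabilityMeasure μ] (hμ : MeasurePreserving (⇑T) μ μ)
    {U : Set X} (hU : IsOpen U) (hpos : 0 < μ U) : IsSyndetic (returnTimes T U U) := by
  intro hthick
  have hne : U.Nonempty := nonempty_of_measure_ne_zero hpos.ne'
  have h0 : (0 : ℤ) ∉ (returnTimes T U U)ᶜ := fun h =>
    h (mem_returnTimes.2 ⟨hne.some, hne.some_mem, hne.some_mem⟩)
  -- More than total mass 1, so two of the k translates must overlap.
  obtain ⟨k, hk⟩ := ENNReal.exists_nat_mul_gt hpos.ne' ENNReal.one_ne_top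
  obtain ⟨S, rfl, hS⟩ := hthick.exists_finset_pairwise h0 k
  have hpre : ∀ i : ℤ, μ (⇑(T ^ i) ⁻¹' U) = μ U := fun i =>
    (measurePreserving_zpow hμ i).measure_preimage hU.measurableSet.nullMeasurableSet
  obtain ⟨i, hi, j, hj, hij, x, hxi, hxj⟩ :=
    exists_nonempty_inter_of_measure_univ_lt_sum_measure μ (s := S)
      (t := fun i : ℤ => ⇑(T ^ i) ⁻¹' U)
      (fun i _ => (hU.preimage (T ^ i).continuous).measurableSet.nullMeasurableSet)
      (by simpa [hpre] using hk)
  rcases hS i hi j hj hij with h | h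
  · exact h (mem_returnTimes.2 ⟨_, hxj, by rwa [← zpow_add_apply, sub_add_cancel]⟩)
  · exact h (mem_returnTimes.2 ⟨_, hxi, by rwa [← zpow_add_apply, sub_add_cancel]⟩)

/-- Equivariance of sections combined with invariance of μ. -/
theorem sectionDist_zpow (hμ : MeasurePreserving (⇑T) μ μ) (U : Set X) {V : Set X}
    (hV : IsOpen V) (n : ℤ) (x y : X) :
    sectionDist μ T U V ((T ^ n) x) ((T ^ n) y) = sectionDist μ T U V x y := by
  have hmeas : ∀ x, MeasurableSet (orbitSection T U V x) := fun x =>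
    (isOpen_orbitSection T U hV x).measurableSet
  rw [sectionDist, sectionDist, Measure.real, Measure.real,
    ← (measurePreserving_zpow hμ n).measure_preimage
      ((hmeas _).symmDiff (hmeas _)).nullMeasurableSet, Set.preimage_symmDiff,
    preimage_orbitSection, preimage_orbitSection]

/-- Each nonempty open set contains a nonempty open subset of small section diameter. -/
theorem exists_isOpen_subset_sectionDist_le [IsProbabilityMeasure μ] {U V U₀ : Set X}
    (hU : IsOpen U) (hV : IsOpen V) (hU₀ : IsOpen U₀) (hne : U₀.Nonempty) {ε : ℝ} (hε : 0 < ε) :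
    ∃ O ⊆ U₀, IsOpen O ∧ O.Nonempty ∧ ∀ x ∈ O, ∀ y ∈ O, sectionDist μ T U V x y ≤ ε := by
  set E := orbitSection T U V with hE
  have hbdd : BddAbove ((fun x => μ.real (E x)) '' U₀) :=
    ⟨1, by rintro _ ⟨x, -, rfl⟩; exact measureReal_le_one⟩
  -- Near the supremum s, nearby sections contain almost all of E(x) but cannot exceed s, so they
  -- almost agree.
  obtain ⟨_, ⟨x, hx, rfl⟩, hxs⟩ := exists_lt_of_lt_csSup (hne.image fun x => μ.real (E x))
    (sub_lt_self (sSup ((fun x => μ.real (E x)) '' U₀)) (show 0 < ε / 4 by positivity))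
  set s := sSup ((fun x => μ.real (E x)) '' U₀) with hs
  let K : Finset {n : ℤ // (T ^ n) x ∈ U} → Set X := fun F => ⋃ n ∈ F, ⇑(T ^ (n : ℤ)) ⁻¹' V
  have hKmono : Monotone K := fun F G h => Set.biUnion_subset_biUnion_left h
  have hKE : ⋃ F, K F = E x := by
    rw [hE, orbitSection_eq_iUnion]
    exact (Set.iUnion_eq_iUnion_finset _).symm
  obtain ⟨F, hF⟩ : ∃ F, s - ε / 4 - ε / 4 < μ.real (K F) := by
    have hlim := tendsto_measure_iUnion_atTop (μ := μ) hKmono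
    rw [hKE] at hlim
    have hlim' : Tendsto (fun F => μ.real (K F)) atTop (𝓝 (μ.real (E x))) :=
      (ENNReal.tendsto_toReal (measure_ne_top μ _)).comp hlim
    exact (hlim'.eventually_const_lt (by linarith)).exists
  have hKm : MeasurableSet (K F) := 
    (show IsOpen (⋃ n ∈ F, ⇑(T ^ (n : ℤ)) ⁻¹' V) from
      isOpen_biUnion fun n _ => hV.preimage (T ^ (n : ℤ)).continuous).measurableSet
  refine ⟨U₀ ∩ ⋂ n ∈ F, ⇑(T ^ (n : ℤ)) ⁻¹' U, Set.inter_subset_left,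
    hU₀.inter (isOpen_biInter_finset fun n _ => hU.preimage (T ^ (n : ℤ)).continuous),
    ⟨x, hx, Set.mem_iInter₂.2 fun n _ => n.2⟩, ?_⟩
  have key : ∀ y ∈ U₀ ∩ ⋂ n ∈ F, ⇑(T ^ (n : ℤ)) ⁻¹' U,
      μ.real (symmDiff (E y) (K F)) ≤ ε / 2 := by
    rintro y ⟨hy, hyF⟩
    have hsub : K F ⊆ E y := fun z hz => by
      obtain ⟨n, hn, hz⟩ := Set.mem_iUnion₂.1 hz
      exact ⟨n, Set.mem_iInter₂.1 hyF n hn, hz⟩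
    rw [symmDiff_of_ge hsub, measureReal_sdiff hsub hKm]
    have : μ.real (E y) ≤ s := le_csSup hbdd ⟨y, hy, rfl⟩
    linarith
  intro y hy z hz
  have h : μ.real (symmDiff (E y) (E z)) ≤
      μ.real (symmDiff (E y) (K F)) + μ.real (symmDiff (K F) (E z)) :=
    measureReal_symmDiff_le _ (measure_ne_top _ _) (measure_ne_top _ _)
  have h1 := key y hy
  have h2 := key z hz
  rw [symmDiff_comm] at h2
  exact h.trans (by linarith)

/-- In a scattering system with an invariant measure of full support, each nonempty open set
contains points whose orbits have small section diameter. -/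
theorem IsScattering.exists_sectionDist_zpow_le [RegularSpace X] (hT : IsScattering T)
    [IsProbabilityMeasure μ] [μ.IsOpenPosMeasure] (hμ : MeasurePreserving (⇑T) μ μ)
    {U V U₀ : Set X} (hU : IsOpen U) (hV : IsOpen V) (hU₀ : IsOpen U₀) (hne : U₀.Nonempty)
    {ε : ℝ} (hε : 0 < ε) : ∃ x ∈ U₀, ∀ k : ℤ, sectionDist μ T U V ((T ^ k) x) x ≤ ε := by
  obtain ⟨O, hOU, hO, ⟨x, hx⟩, hsmall⟩ := exists_isOpen_subset_sectionDist_le (T := T) (μ := μ)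
    hU hV hU₀ hne (show 0 < ε / 6 by positivity)
  have htri := sectionDist_triangle (μ := μ) (T := T) U V
  have hinv := sectionDist_zpow hμ U hV
  have hcomm := sectionDist_comm (μ := μ) (T := T) U V
  refine ⟨x, hOU hx, fun k => ?_⟩
  have hret : ∀ a ∈ returnTimes T O O, sectionDist μ T U V ((T ^ a) x) x ≤ ε / 3 := fun a ha => by
    obtain ⟨u, hu, hau⟩ := mem_returnTimes.1 ha
    have h1 := htri ((T ^ a) x) ((T ^ a) u) x
    rw [hinv] at h1
    linarith [hsmall x hx u hu, hsmall _ hau x hx]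
  -- The time a - b carries some y in O into T^k O; the errors are ε/6 twice and ε/3 twice.
  obtain ⟨a, ha, b, hb, hab⟩ := hT.exists_sub_mem_returnTimes
    (isSyndetic_returnTimes hμ hO (hO.measure_pos μ ⟨x, hx⟩)) hO ⟨x, hx⟩
    (hO.preimage (T ^ (-k)).continuous) ⟨(T ^ k) x, by
      rw [Set.mem_preimage, ← zpow_add_apply, neg_add_cancel]; exact hx⟩
  obtain ⟨y, hy, hyk⟩ := mem_returnTimes.1 hab
  have h1 := htri ((T ^ k) x) ((T ^ (a - b)) y) x
  have h2 := htri ((T ^ (a - b)) y) ((T ^ (a - b)) x) x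
  have h3 : sectionDist μ T U V ((T ^ k) x) ((T ^ (a - b)) y) ≤ ε / 6 := by
    rw [← hinv (-k), ← zpow_add_apply, neg_add_cancel]
    exact hsmall x hx _ hyk
  have h4 : sectionDist μ T U V ((T ^ (a - b)) y) ((T ^ (a - b)) x) ≤ ε / 6 := by
    rw [hinv]
    exact hsmall y hy x hx
  have h5 : sectionDist μ T U V ((T ^ (a - b)) x) x =
      sectionDist μ T U V ((T ^ a) x) ((T ^ b) x) := by
    rw [← hinv b, ← zpow_add_apply, add_sub_cancel]
  have h6 := htri ((T ^ a) x) x ((T ^ b) x)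
  have h7 := hcomm x ((T ^ b) x)
  linarith [hret a ha, hret b hb]

end Measure

end TDS

theorem mainTheorem6 {X : Type*} [MetricSpace X] [CompactSpace X] [MeasurableSpace X]
    [BorelSpace X] (T : X ≃ₜ X) (hT : TDS.IsScattering T)
    (μ : Measure X) [IsProbabilityMeasure μ] (hμ : MeasurePreserving (⇑T) μ μ)
    (hsupp : μ.IsOpenPosMeasure) :
    TDS.IsWeakMixing T := by

  intro W₁ W₂ hW₁ ⟨⟨x₁, y₁⟩, h₁⟩ hW₂ ⟨⟨x₂, y₂⟩, h₂⟩
  obtain ⟨U₁, V₁, hU₁, hV₁, hx₁, hy₁, hsub₁⟩ := isOpen_prod_iff.1 hW₁ x₁ y₁ h₁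
  obtain ⟨U₂, V₂, hU₂, hV₂, hx₂, hy₂, hsub₂⟩ := isOpen_prod_iff.1 hW₂ x₂ y₂ h₂
  by_contra hempty
  obtain ⟨j, hj⟩ := hT.isTransitive U₁ U₂ hU₁ ⟨x₁, hx₁⟩ hU₂ ⟨x₂, hx₂⟩
  obtain ⟨x₀, hx₀, hjx₀⟩ := TDS.mem_returnTimes.1 hj
  have hV₂' : IsOpen (⇑(T ^ j) ⁻¹' V₂) := hV₂.preimage (T ^ j).continuous
  obtain ⟨k, hk⟩ := hT.isTransitive V₁ _ hV₁ ⟨y₁, hy₁⟩ hV₂'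
    ⟨(T ^ (-j)) y₂, by
      rw [Set.mem_preimage, ← TDS.zpow_add_apply, add_neg_cancel]; exact hy₂⟩
  obtain ⟨v, hv, hkv⟩ := TDS.mem_returnTimes.1 hk
  -- Time -k puts Q inside E(T^k x); a point of Q in E(x) would give a passage from W₁ to W₂.
  set Q : Set X := ⇑(T ^ (-k)) ⁻¹' V₁ ∩ ⇑(T ^ j) ⁻¹' V₂ with hQ
  have hQpos : 0 < μ.real Q := by
    refine ENNReal.toReal_pos (IsOpen.measure_ne_zero μ
      ((hV₁.preimage (T ^ (-k)).continuous).inter hV₂') ⟨(T ^ k) v, ?_, hkv⟩) (measure_ne_top μ Q)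
    rw [Set.mem_preimage, ← TDS.zpow_add_apply, neg_add_cancel]
    exact hv
  obtain ⟨x, ⟨hxU₁, hxU₂⟩, hx⟩ := hT.exists_sectionDist_zpow_le hμ hU₁ hV₁
    (hU₁.inter (hU₂.preimage (T ^ j).continuous)) ⟨x₀, hx₀, hjx₀⟩ (half_pos hQpos)
  have hQsub : Q ⊆ symmDiff (TDS.orbitSection T U₁ V₁ ((T ^ k) x))
      (TDS.orbitSection T U₁ V₁ x) := by
    rintro z ⟨hz₁, hz₂⟩
    refine Or.inl ⟨⟨-k, ?_, hz₁⟩, ?_⟩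
    · rw [← TDS.zpow_add_apply, neg_add_cancel]
      exact hxU₁
    · rintro ⟨n, hnx, hnz⟩
      refine hempty ⟨j - n, TDS.mem_returnTimes.2 ⟨((T ^ n) x, (T ^ n) z), hsub₁ ⟨hnx, hnz⟩, ?_⟩⟩
      rw [TDS.prodCongr_zpow_apply]
      refine hsub₂ ⟨?_, ?_⟩ <;> dsimp only <;> rw [← TDS.zpow_add_apply, sub_add_cancel]
      · exact hxU₂
      · exact hz₂
  have hle : μ.real Q ≤ μ.real Q / 2 := (measureReal_mono hQsub).trans (hx k)
  linarith
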